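/- For $x\in I:=[0,1)$ let $x=\sum_{j\ge 0}x_j2^{-j-1}$, $x_j\in\{0,1\}$, be its dyadic expansion (the one terminating in zeros if $x$ is a dyadic rational), and for $n\in\mathbb N=\{0,1,2,\dots\}$ let $n=\sum_{j\ge0}n_j2^j$, $n_j\in\{0,1\}$. Let $\omega_n(x):=\prod_{k\ge 0}\big((-1)^{x_k}\big)^{n_k}$ be the Walsh--Paley functions, and for $a\in\mathbb N$ let $I_a:=\{y\in I: y_0=\dots=y_{a-1}=0\}=[0,2^{-a})$. Define the triangular Dirichlet and Fejér kernels for $x=(x^1,x^2)\in I^2$ by $$D_k^{\triangle}(x):=\sum_{i=0}^{k-1}\sum_{j=0}^{k-i-1}\omega_i(x^1)\,\omega_j(x^2)\quad(k\in\mathbb N),\qquad K_n^{\triangle}(x):=\frac1n\sum_{k=0}^{n-1}D_k^{\triangle}(x)\quad(n\ge 1).$$ Then there is an absolute constant $C<\infty$ such that for every $a\in\mathbb N$ $$\int_{I^2\setminus(I_a\times I_a)}\ \sup_{n\ge 2^a}\big|K_n^{\triangle}(x)\big|\,dx\le C,$$ where $dx$ is two-dimensional Lebesgue measure and the supremum is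 over integers $n\ge 2^a$ (with values in $[0,\infty]$). -/

import Mathlib

open MeasureTheory
open scoped ENNReal NNReal

noncomputable section

namespace WalshTriangle

/-- The `j`-th coordinate `x_j ∈ {0, 1}` of the dyadic expansion
`x = ∑ j, x_j * 2 ^ (-j - 1)` of `x ∈ [0, 1)`; for dyadic rationals this is the expansion
which terminates in zeros. -/
def digit (x : ℝ) (j : ℕ) : ℕ := ⌊x * 2 ^ (j + 1)⌋₊ % 2

/-- The `j`-th coordinate `n_j ∈ {0, 1}` of the dyadic expansion `n = ∑ j, n_j * 2 ^ j`. -/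
def natDigit (n j : ℕ) : ℕ := n / 2 ^ j % 2

/-- The dyadic interval `I_n(x) = {y ∈ [0, 1) : y_0 = x_0, …, y_{n-1} = x_{n-1}}`. -/
def dyadicInterval (n : ℕ) (x : ℝ) : Set ℝ :=
  {y | y ∈ Set.Ico (0 : ℝ) 1 ∧ ∀ j < n, digit y j = digit x j}

/-- The Rademacher function `r_k(x) = (-1) ^ x_k`. -/
def rademacher (k : ℕ) (x : ℝ) : ℝ := (-1) ^ digit x k

/-- The Walsh–Paley function `ω_n(x) = ∏ k, r_k(x) ^ n_k`. The coordinates `n_k` vanish for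
`k > Nat.log 2 n`, so the product may be restricted to `k ≤ Nat.log 2 n`. -/
def walsh (n : ℕ) (x : ℝ) : ℝ :=
  ∏ k ∈ Finset.range (Nat.log 2 n + 1), rademacher k x ^ natDigit n k

/-- The triangular Dirichlet kernel
`D_k(x¹, x²) = ∑_{i=0}^{k-1} ∑_{j=0}^{k-i-1} ω_i(x¹) ω_j(x²)`. -/
def triangleDirichlet (k : ℕ) (x : ℝ × ℝ) : ℝ :=
  ∑ i ∈ Finset.range k, ∑ j ∈ Finset.range (k - i), walsh i x.1 * walsh j x.2

/-- The triangular Fejér kernel `K_n = (1 / n) ∑_{k=0}^{n-1} D_k`. -/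
def triangleFejer (n : ℕ) (x : ℝ × ℝ) : ℝ :=
  (1 / (n : ℝ)) * ∑ k ∈ Finset.range n, triangleDirichlet k x

end WalshTriangle

end

noncomputable section

namespace WalshTriangle

/-! The sums `n * K_n` are coefficients of the power series `W₁ W₂ / (1 - X)²`, where `Wᵢ` is the
generating series of the Walsh functions at the `i`-th coordinate. Since `Wᵢ = ∏ (1 ± X^(2^k))` and
`1 / (1 - X) = ∏ (1 + X^(2^k))`, truncation at `K` digits gives a product with one factor per pair
of digits. Its height bounds `|n * K_n|` for all `n ≤ 2^K`, so the supremum over a dyadic block of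
`n` is replaced by one number depending on a digit word.

Peeling off the first pair gives recursions for the heights of the `i`-th differences. A pair of
zeros multiplies the height by at most 8, which is exactly the normalisation: 4 from the measure of
a digit square, 2 from `1 / n`. Any other pair supplies a factor `1 - X²` or its square, so the tail
enters through differences, and a weighted sum of these grows on average by at most 7 per pair
(`sum_potential_cons_le`).

Off `I_a × I_a` a nonzero pair occurs among the first `a`. Summing over its first position bounds
the total over words of length `a + d` by a constant times `7^d 8^a` (`sumWords_offHeight_le`). The
blocks thus contribute a geometric series of ratio `7/8`, uniformly in `a`. -/

/-! ### Heights of integer polynomials -/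

/-- The largest absolute value of a coefficient of an integer polynomial. -/
def height (p : Polynomial ℤ) : ℕ := p.support.sup fun n => (p.coeff n).natAbs

theorem natAbs_coeff_le_height (p : Polynomial ℤ) (n : ℕ) : (p.coeff n).natAbs ≤ height p := by
  by_cases h : n ∈ p.support
  · exact Finset.le_sup (f := fun n => (p.coeff n).natAbs) h
  · simp [Polynomial.notMem_support_iff.1 h]

theorem height_le {p : Polynomial ℤ} {B : ℕ} (h : ∀ n, (p.coeff n).natAbs ≤ B) : height p ≤ B :=
  Finset.sup_le fun n _ => h n

theorem natAbs_coeff_X_pow_mul_expand_le (p : Polynomial ℤ) (i n : ℕ) :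
    ((Polynomial.X ^ i * Polynomial.expand ℤ 2 p).coeff n).natAbs ≤
      if i % 2 = n % 2 then height p else 0 := by
  rw [Polynomial.coeff_X_pow_mul', Polynomial.coeff_expand two_pos]
  have := natAbs_coeff_le_height p ((n - i) / 2)
  split_ifs <;> omega

/-- Multiplying `p (X ^ 2)` by a polynomial of degree at most four only mixes coefficients whose
indices have the same parity. -/
theorem height_mul_expand_le (c₀ c₁ c₂ c₃ c₄ : ℤ) (M : ℕ) (p r : Polynomial ℤ)
    (hr : r = ((c₀ : Polynomial ℤ) + (c₁ : Polynomial ℤ) * Polynomial.X +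
      (c₂ : Polynomial ℤ) * Polynomial.X ^ 2 + (c₃ : Polynomial ℤ) * Polynomial.X ^ 3 +
      (c₄ : Polynomial ℤ) * Polynomial.X ^ 4) * Polynomial.expand ℤ 2 p)
    (he : c₀.natAbs + c₂.natAbs + c₄.natAbs ≤ M) (ho : c₁.natAbs + c₃.natAbs ≤ M) :
    height r ≤ M * height p := by
  refine height_le fun n => ?_
  set e := Polynomial.expand ℤ 2 p with hedef
  have h := fun i => natAbs_coeff_X_pow_mul_expand_le p i n
  rw [← hedef] at h
  have key : r.coeff n = c₀ * (Polynomial.X ^ 0 * e).coeff n + c₁ * (Polynomial.X ^ 1 * e).coeff n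
      + c₂ * (Polynomial.X ^ 2 * e).coeff n + c₃ * (Polynomial.X ^ 3 * e).coeff n
      + c₄ * (Polynomial.X ^ 4 * e).coeff n := by
    have : r = Polynomial.C c₀ * (Polynomial.X ^ 0 * e) + Polynomial.C c₁ * (Polynomial.X ^ 1 * e)
      + Polynomial.C c₂ * (Polynomial.X ^ 2 * e) + Polynomial.C c₃ * (Polynomial.X ^ 3 * e)
      + Polynomial.C c₄ * (Polynomial.X ^ 4 * e) := by
      rw [hr]; simp only [eq_intCast]; ring
    rw [this]
    simp only [Polynomial.coeff_add, Polynomial.coeff_C_mul]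
  have tri : (r.coeff n).natAbs ≤ c₀.natAbs * ((Polynomial.X ^ 0 * e).coeff n).natAbs
      + c₁.natAbs * ((Polynomial.X ^ 1 * e).coeff n).natAbs
      + c₂.natAbs * ((Polynomial.X ^ 2 * e).coeff n).natAbs
      + c₃.natAbs * ((Polynomial.X ^ 3 * e).coeff n).natAbs
      + c₄.natAbs * ((Polynomial.X ^ 4 * e).coeff n).natAbs := by
    rw [key]
    simp only [← Int.natAbs_mul]
    omega
  have h0 := h 0
  have h1 := h 1
  have h2 := h 2
  have h3 := h 3
  have h4 := h 4
  rcases Nat.mod_two_eq_zero_or_one n with hn | hn <;> simp only [hn] at h0 h1 h2 h3 h4 <;>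
    norm_num at h0 h1 h2 h3 h4
  · calc _ ≤ _ := tri
      _ ≤ c₀.natAbs * height p + c₁.natAbs * 0 + c₂.natAbs * height p + c₃.natAbs * 0
          + c₄.natAbs * height p := by
        gcongr <;> simp_all
      _ = (c₀.natAbs + c₂.natAbs + c₄.natAbs) * height p := by ring
      _ ≤ _ := by gcongr
  · calc _ ≤ _ := tri
      _ ≤ c₀.natAbs * 0 + c₁.natAbs * height p + c₂.natAbs * 0 + c₃.natAbs * height p
          + c₄.natAbs * 0 := by
        gcongr <;> simp_all
      _ = (c₁.natAbs + c₃.natAbs) * height p := by ring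
      _ ≤ _ := by gcongr

/-! ### Generating polynomials and one-digit recursions -/

/-- The value `±1` of a Rademacher function on a digit. -/
def sign (b : Bool) : ℤ := if b then -1 else 1

/-- The polynomial `∑ n < 2 ^ K, ω_n X ^ n` of Walsh values for the digits `b_0, …, b_{K-1}`. -/
def walshPoly : List Bool → Polynomial ℤ
  | [] => 1
  | b :: l => (1 + Polynomial.C (sign b) * Polynomial.X) * Polynomial.expand ℤ 2 (walshPoly l)

/-- The factor which a pair of digits contributes to the generating function of the sums
`n * K_n`. -/
def kernelFactor (t : Bool × Bool) : Polynomial ℤ :=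
  (1 + Polynomial.X) ^ 2 * (1 + Polynomial.C (sign t.1) * Polynomial.X) *
    (1 + Polynomial.C (sign t.2) * Polynomial.X)

/-- The generating polynomial of the sums `n * K_n` at a point with given leading digits. -/
def kernelPoly : List (Bool × Bool) → Polynomial ℤ
  | [] => 1
  | t :: l => kernelFactor t * Polynomial.expand ℤ 2 (kernelPoly l)

/-- The largest `i`-th difference of the coefficients of the generating polynomial. -/
def diffHeight (i : ℕ) (l : List (Bool × Bool)) : ℕ :=
  height ((1 - Polynomial.X) ^ i * kernelPoly l)

/-- Since `1 - X²` is the expansion of `1 - X`, a factor `(1 - X²)^j` split off from the first pair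
becomes a `j`-th difference of the tail. -/
theorem diffHeight_cons_le (c₀ c₁ c₂ c₃ c₄ : ℤ) (M i j : ℕ) (t : Bool × Bool)
    (l : List (Bool × Bool))
    (hr : (1 - Polynomial.X) ^ i * kernelFactor t =
      ((c₀ : Polynomial ℤ) + (c₁ : Polynomial ℤ) * Polynomial.X +
      (c₂ : Polynomial ℤ) * Polynomial.X ^ 2 + (c₃ : Polynomial ℤ) * Polynomial.X ^ 3 +
      (c₄ : Polynomial ℤ) * Polynomial.X ^ 4) * (1 - Polynomial.X ^ 2) ^ j)
    (he : c₀.natAbs + c₂.natAbs + c₄.natAbs ≤ M) (ho : c₁.natAbs + c₃.natAbs ≤ M) :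
    diffHeight i (t :: l) ≤ M * diffHeight j l := by
  refine height_mul_expand_le c₀ c₁ c₂ c₃ c₄ M _ _ ?_ he ho
  rw [kernelPoly, ← mul_assoc, hr]
  simp only [map_mul, map_pow, map_sub, map_one, Polynomial.expand_X, mul_assoc]

/-- For two zeros, `(1 - X)^i (1 + X)^4 = (1 + X)^(4 - i) (1 - X²)^i`. For `i ≤ 3` the even and odd
coefficients of `(1 + X)^(4 - i)` each sum to `2^(3 - i)`, so each difference halves the growth. -/
theorem diffHeight_zero_cons_ff (l : List (Bool × Bool)) :
    diffHeight 0 ((false, false) :: l) ≤ 8 * diffHeight 0 l :=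
  diffHeight_cons_le 1 4 6 4 1 8 0 0 _ l (by simp [kernelFactor, sign]; ring)
    (by norm_num) (by norm_num)

theorem diffHeight_one_cons_ff (l : List (Bool × Bool)) :
    diffHeight 1 ((false, false) :: l) ≤ 4 * diffHeight 1 l :=
  diffHeight_cons_le 1 3 3 1 0 4 1 1 _ l (by simp [kernelFactor, sign]; ring)
    (by norm_num) (by norm_num)

theorem diffHeight_two_cons_ff (l : List (Bool × Bool)) :
    diffHeight 2 ((false, false) :: l) ≤ 2 * diffHeight 2 l :=
  diffHeight_cons_le 1 2 1 0 0 2 2 2 _ l (by simp [kernelFactor, sign]; ring)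
    (by norm_num) (by norm_num)

theorem diffHeight_three_cons_ff (l : List (Bool × Bool)) :
    diffHeight 3 ((false, false) :: l) ≤ 1 * diffHeight 3 l :=
  diffHeight_cons_le 1 1 0 0 0 1 3 3 _ l (by simp [kernelFactor, sign]; ring)
    (by norm_num) (by norm_num)

theorem kernelFactor_of_ne {t : Bool × Bool} (ht : t.1 ≠ t.2) :
    kernelFactor t = (1 + Polynomial.X) ^ 2 * (1 - Polynomial.X ^ 2) := by
  obtain ⟨_ | _, _ | _⟩ := t <;> simp [kernelFactor, sign] at ht ⊢ <;> ring

theorem diffHeight_zero_cons_of_ne {t : Bool × Bool} (ht : t.1 ≠ t.2) (l : List (Bool × Bool)) :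
    diffHeight 0 (t :: l) ≤ 2 * diffHeight 1 l :=
  diffHeight_cons_le 1 2 1 0 0 2 0 1 _ l (by rw [kernelFactor_of_ne ht]; push_cast; ring)
    (by norm_num) (by norm_num)

theorem diffHeight_one_cons_of_ne {t : Bool × Bool} (ht : t.1 ≠ t.2) (l : List (Bool × Bool)) :
    diffHeight 1 (t :: l) ≤ 1 * diffHeight 2 l :=
  diffHeight_cons_le 1 1 0 0 0 1 1 2 _ l (by rw [kernelFactor_of_ne ht]; push_cast; ring)
    (by norm_num) (by norm_num)

theorem diffHeight_two_cons_of_ne {t : Bool × Bool} (ht : t.1 ≠ t.2) (l : List (Bool × Bool)) :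
    diffHeight 2 (t :: l) ≤ 1 * diffHeight 3 l :=
  diffHeight_cons_le 1 0 0 0 0 1 2 3 _ l (by rw [kernelFactor_of_ne ht]; push_cast; ring)
    (by norm_num) (by norm_num)

theorem diffHeight_three_cons_of_ne {t : Bool × Bool} (ht : t.1 ≠ t.2) (l : List (Bool × Bool)) :
    diffHeight 3 (t :: l) ≤ 1 * diffHeight 3 l :=
  diffHeight_cons_le 1 (-1) 0 0 0 1 3 3 _ l (by rw [kernelFactor_of_ne ht]; push_cast; ring)
    (by norm_num) (by norm_num)

/-- For two ones the whole factor is `(1 - X²)²`, so two differences pass to the tail. -/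
theorem diffHeight_zero_cons_tt (l : List (Bool × Bool)) :
    diffHeight 0 ((true, true) :: l) ≤ 1 * diffHeight 2 l :=
  diffHeight_cons_le 1 0 0 0 0 1 0 2 _ l (by simp [kernelFactor, sign]; ring)
    (by norm_num) (by norm_num)

theorem diffHeight_one_cons_tt (l : List (Bool × Bool)) :
    diffHeight 1 ((true, true) :: l) ≤ 1 * diffHeight 2 l :=
  diffHeight_cons_le 1 (-1) 0 0 0 1 1 2 _ l (by simp [kernelFactor, sign]; ring)
    (by norm_num) (by norm_num)

theorem diffHeight_two_cons_tt (l : List (Bool × Bool)) :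
    diffHeight 2 ((true, true) :: l) ≤ 2 * diffHeight 2 l :=
  diffHeight_cons_le 1 (-2) 1 0 0 2 2 2 _ l (by simp [kernelFactor, sign]; ring)
    (by norm_num) (by norm_num)

theorem diffHeight_three_cons_tt (l : List (Bool × Bool)) :
    diffHeight 3 ((true, true) :: l) ≤ 4 * diffHeight 2 l :=
  diffHeight_cons_le 1 (-3) 3 (-1) 0 4 3 2 _ l (by simp [kernelFactor, sign]; ring)
    (by norm_num) (by norm_num)

/-! ### Sums over digit words -/

/-- The sum of `F` over all words of length `K` in pairs of digits. -/
def sumWords : ℕ → (List (Bool × Bool) → ℕ) → ℕ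
  | 0, F => F []
  | K + 1, F => ∑ t : Bool × Bool, sumWords K fun l => F (t :: l)

theorem sumWords_mono {F G : List (Bool × Bool) → ℕ} (h : ∀ l, F l ≤ G l) (K : ℕ) :
    sumWords K F ≤ sumWords K G := by
  induction K generalizing F G with
  | zero => exact h []
  | succ K ih => exact Finset.sum_le_sum fun t _ => ih fun l => h (t :: l)

theorem sumWords_add (F G : List (Bool × Bool) → ℕ) (K : ℕ) :
    (sumWords K fun l => F l + G l) = sumWords K F + sumWords K G := by
  induction K generalizing F G with
  | zero => rfl
  | succ K ih => simp only [sumWords, ih, Finset.sum_add_distrib]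

theorem sumWords_mul (c : ℕ) (F : List (Bool × Bool) → ℕ) (K : ℕ) :
    (sumWords K fun l => c * F l) = c * sumWords K F := by
  induction K generalizing F with
  | zero => rfl
  | succ K ih => simp only [sumWords, ih, Finset.mul_sum]

/-- A combination of the difference heights which grows at most by the factor `7` per digit. -/
def potential (l : List (Bool × Bool)) : ℕ :=
  2 * diffHeight 1 l + 6 * diffHeight 2 l + 3 * diffHeight 3 l

/-- With `hᵢ` the `i`-th difference height, summing over the four pairs sends `h₁, h₂, h₃` to at
most `4h₁ + 3h₂`, `4h₂ + 2h₃`, `4h₂ + 3h₃`. The weights 2, 6, 3 then give `8h₁ + 42h₂ + 21h₃`, where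
42 and 21 are exactly 7 times the weights. -/
theorem sum_potential_cons_le (l : List (Bool × Bool)) :
    ∑ t : Bool × Bool, potential (t :: l) ≤ 7 * potential l := by
  simp only [Fintype.sum_prod_type, Fintype.sum_bool, potential]
  have hft : ((false, true) : Bool × Bool).1 ≠ ((false, true) : Bool × Bool).2 := by decide
  have htf : ((true, false) : Bool × Bool).1 ≠ ((true, false) : Bool × Bool).2 := by decide
  have := diffHeight_one_cons_ff l
  have := diffHeight_two_cons_ff l
  have := diffHeight_three_cons_ff l
  have := diffHeight_one_cons_tt l
  have := diffHeight_two_cons_tt l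
  have := diffHeight_three_cons_tt l
  have := diffHeight_one_cons_of_ne hft l
  have := diffHeight_two_cons_of_ne hft l
  have := diffHeight_three_cons_of_ne hft l
  have := diffHeight_one_cons_of_ne htf l
  have := diffHeight_two_cons_of_ne htf l
  have := diffHeight_three_cons_of_ne htf l
  omega

theorem sum_sumWords (F : Bool × Bool → List (Bool × Bool) → ℕ) (K : ℕ) :
    ∑ t : Bool × Bool, sumWords K (F t) = sumWords K fun l => ∑ t : Bool × Bool, F t l := by
  simp only [Fintype.sum_prod_type, Fintype.sum_bool, sumWords_add]

theorem potential_nil_le : potential [] ≤ 23 := by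
  have h1 : diffHeight 1 [] ≤ 1 * height 1 :=
    height_mul_expand_le 1 (-1) 0 0 0 1 1 _ (by simp [kernelPoly]; ring)
      (by norm_num) (by norm_num)
  have h2 : diffHeight 2 [] ≤ 2 * height 1 :=
    height_mul_expand_le 1 (-2) 1 0 0 2 1 _ (by simp [kernelPoly]; ring)
      (by norm_num) (by norm_num)
  have h3 : diffHeight 3 [] ≤ 3 * height 1 := by
    -- Separating parities would only give 4, so the coefficients are read off directly.
    have key : ((1 - Polynomial.X) ^ 3 * kernelPoly [] : Polynomial ℤ) =
        Polynomial.C 1 + Polynomial.C (-3) * Polynomial.X + Polynomial.C 3 * Polynomial.X ^ 2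
          + Polynomial.C (-1) * Polynomial.X ^ 3 := by
      simp [kernelPoly]; ring
    have h1 : height 1 = 1 := le_antisymm
      (height_le fun n => by rw [Polynomial.coeff_one]; split_ifs <;> simp)
      (by simpa using natAbs_coeff_le_height 1 0)
    rw [h1, diffHeight, key]
    refine height_le fun n => ?_
    simp only [Polynomial.coeff_add, Polynomial.coeff_C_mul, Polynomial.coeff_X_pow,
      Polynomial.coeff_C, Polynomial.coeff_X]
    split_ifs <;> omega
  have h0 : height 1 ≤ 1 :=
    height_le fun n => by rw [Polynomial.coeff_one]; split_ifs <;> simp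
  unfold potential
  omega

theorem sumWords_potential_le (K : ℕ) : sumWords K potential ≤ 23 * 7 ^ K := by
  induction K with
  | zero => simpa [sumWords] using potential_nil_le
  | succ K ih =>
    calc sumWords (K + 1) potential = _ := sum_sumWords (fun t l => potential (t :: l)) K
      _ ≤ sumWords K fun l => 7 * potential l := sumWords_mono sum_potential_cons_le K
      _ = 7 * sumWords K potential := sumWords_mul _ _ _
      _ ≤ 7 * (23 * 7 ^ K) := by gcongr
      _ = _ := by ring

/-- The height of the generating polynomial, restricted to words for which the first `a` pairs of
digits do not all vanish. -/
def offHeight (a : ℕ) (l : List (Bool × Bool)) : ℕ :=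
  if ∀ t ∈ l.take a, t = (false, false) then 0 else diffHeight 0 l

/-- Only a pair of zeros leaves the restriction to be met by the tail. The other three pairs cost at
most `4h₁ + h₂`, which is below twice the potential. -/
theorem sum_offHeight_cons_le (a : ℕ) (l : List (Bool × Bool)) :
    ∑ t : Bool × Bool, offHeight (a + 1) (t :: l) ≤ 8 * offHeight a l + 2 * potential l := by
  have hle : ∀ t, offHeight (a + 1) (t :: l) ≤ diffHeight 0 (t :: l) := fun t => by
    unfold offHeight; split_ifs <;> simp
  have hff : offHeight (a + 1) ((false, false) :: l) ≤ 8 * offHeight a l := by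
    simp only [offHeight, List.take_succ_cons, List.forall_mem_cons, true_and]
    split_ifs
    · simp
    · exact diffHeight_zero_cons_ff l
  have h1 := (hle (false, true)).trans (diffHeight_zero_cons_of_ne (by decide) l)
  have h2 := (hle (true, false)).trans (diffHeight_zero_cons_of_ne (by decide) l)
  have h3 := (hle (true, true)).trans (diffHeight_zero_cons_tt l)
  simp only [Fintype.sum_prod_type, Fintype.sum_bool, potential]
  omega

/-- The recursion is `S ↦ 8S + 46 * 7^(a + d)` with `46 = 2 * 23`; the added term on the left makes
the induction close exactly. -/
theorem sumWords_offHeight_le (a d : ℕ) :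
    sumWords (a + d) (offHeight a) + 46 * 7 ^ (a + d) ≤ 46 * 7 ^ d * 8 ^ a := by
  induction a with
  | zero =>
    have : sumWords (0 + d) (offHeight 0) ≤ sumWords (0 + d) fun l => 0 * potential l :=
      sumWords_mono (fun l => by simp [offHeight]) _
    rw [sumWords_mul] at this
    simp at this ⊢
    exact this
  | succ a ih =>
    have h : sumWords (a + d + 1) (offHeight (a + 1)) ≤
        8 * sumWords (a + d) (offHeight a) + 2 * sumWords (a + d) potential := by
      calc _ = _ := sum_sumWords (fun t l => offHeight (a + 1) (t :: l)) (a + d)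
        _ ≤ sumWords (a + d) fun l => 8 * offHeight a l + 2 * potential l :=
          sumWords_mono (sum_offHeight_cons_le a) _
        _ = _ := by rw [sumWords_add, sumWords_mul, sumWords_mul]
    have hp := sumWords_potential_le (a + d)
    rw [show a + 1 + d = a + d + 1 by ring, pow_succ 7, pow_succ 8]
    linarith

/-! ### Fejér sums as coefficients -/

/-- The first `K` terms of a sequence. -/
def firstTerms {α : Type*} : ℕ → (ℕ → α) → List α
  | 0, _ => []
  | K + 1, b => b 0 :: firstTerms K fun j => b (j + 1)

theorem map_firstTerms {α β : Type*} (f : α → β) (K : ℕ) (b : ℕ → α) :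
    (firstTerms K b).map f = firstTerms K fun j => f (b j) := by
  induction K generalizing b with
  | zero => rfl
  | succ K ih => simp [firstTerms, ih]

theorem mem_take_firstTerms {α : Type*} {a K j : ℕ} (ha : j < a) (hK : j < K) (b : ℕ → α) :
    b j ∈ (firstTerms K b).take a := by
  induction j generalizing a K b with
  | zero =>
    obtain ⟨a, rfl⟩ := Nat.exists_eq_succ_of_ne_zero ha.ne'
    obtain ⟨K, rfl⟩ := Nat.exists_eq_succ_of_ne_zero hK.ne'
    simp [firstTerms]
  | succ j ih =>
    obtain ⟨a, rfl⟩ := Nat.exists_eq_succ_of_ne_zero (Nat.ne_zero_of_lt ha)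
    obtain ⟨K, rfl⟩ := Nat.exists_eq_succ_of_ne_zero (Nat.ne_zero_of_lt hK)
    simp only [firstTerms, Nat.succ_eq_add_one, List.take_succ_cons]
    exact List.mem_cons_of_mem _ (ih (by omega) (by omega) fun j => b (j + 1))

theorem coeff_one_add_C_mul_X_mul_expand (s : ℤ) (p : Polynomial ℤ) (n : ℕ) :
    ((1 + Polynomial.C s * Polynomial.X) * Polynomial.expand ℤ 2 p).coeff n =
      s ^ (n % 2) * p.coeff (n / 2) := by
  have h : (1 + Polynomial.C s * Polynomial.X) * Polynomial.expand ℤ 2 p =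
      Polynomial.expand ℤ 2 p + Polynomial.C s * (Polynomial.X ^ 1 * Polynomial.expand ℤ 2 p) := by
    ring
  rw [h, Polynomial.coeff_add, Polynomial.coeff_C_mul, Polynomial.coeff_X_pow_mul',
    Polynomial.coeff_expand two_pos, Polynomial.coeff_expand two_pos]
  rcases Nat.mod_two_eq_zero_or_one n with hn | hn
  · rw [if_pos (by omega)]
    split_ifs <;> first | omega | simp [hn]
  · rw [if_neg (by omega), if_pos (by omega), if_pos (by omega), hn,
      show (n - 1) / 2 = n / 2 by omega]
    simp

theorem coeff_walshPoly (K n : ℕ) (hn : n < 2 ^ K) (b : ℕ → Bool) :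
    (walshPoly (firstTerms K b)).coeff n = ∏ k ∈ Finset.range K, sign (b k) ^ natDigit n k := by
  induction K generalizing n b with
  | zero =>
    have : n = 0 := by simpa using hn
    subst this
    simp [firstTerms, walshPoly]
  | succ K ih =>
    rw [firstTerms, walshPoly, coeff_one_add_C_mul_X_mul_expand, ih _ (by omega),
      Finset.prod_range_succ', mul_comm]
    congr 1
    · refine Finset.prod_congr rfl fun k _ => ?_
      rw [natDigit, natDigit, Nat.div_div_eq_div_mul, pow_succ']
    · simp [natDigit]

/-- The sequence of binary digits of `x`. -/
def bit (x : ℝ) (j : ℕ) : Bool := decide (digit x j = 1)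

theorem rademacher_eq_sign (k : ℕ) (x : ℝ) : rademacher k x = sign (bit x k) := by
  have : digit x k = 0 ∨ digit x k = 1 := Nat.mod_two_eq_zero_or_one _
  rcases this with h | h <;> simp [rademacher, sign, bit, h]

theorem walsh_eq_coeff (K n : ℕ) (hn : n < 2 ^ K) (x : ℝ) :
    walsh n x = ((walshPoly (firstTerms K (bit x))).coeff n : ℤ) := by
  rw [coeff_walshPoly K n hn, walsh]
  push_cast
  simp only [rademacher_eq_sign]
  have hz : ∀ k, n < 2 ^ k → natDigit n k = 0 := fun k hk => by
    rw [natDigit, Nat.div_eq_of_lt hk]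
  have ext : ∀ M M' : ℕ, M ≤ M' → n < 2 ^ M →
      ∏ k ∈ Finset.range M, ((sign (bit x k) : ℤ) : ℝ) ^ natDigit n k =
      ∏ k ∈ Finset.range M', ((sign (bit x k) : ℤ) : ℝ) ^ natDigit n k := fun M M' hM hnM => by
    refine Finset.prod_subset (Finset.range_mono hM) fun k _ hk => ?_
    rw [hz k (hnM.trans_le (Nat.pow_le_pow_right two_pos (by simpa using hk))), pow_zero]
  rw [ext _ (max (Nat.log 2 n + 1) K) (le_max_left _ _) (Nat.lt_pow_succ_log_self one_lt_two n),
    ext K _ (le_max_right _ _) hn]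

/-- The two all-`false` words are truncations of `1 / (1 - X)`: multiplying by each one takes
partial sums of coefficients of index below `2^K`. -/
theorem kernelPoly_eq (l : List (Bool × Bool)) :
    kernelPoly l = walshPoly (l.map Prod.fst) * walshPoly (l.map Prod.snd) *
      walshPoly (l.map fun _ => false) * walshPoly (l.map fun _ => false) := by
  induction l with
  | nil => simp [kernelPoly, walshPoly]
  | cons t l ih =>
    simp only [kernelPoly, ih, List.map_cons, walshPoly, kernelFactor, map_mul]
    simp only [sign, Bool.false_eq_true, if_false, map_one]
    ring

theorem coeff_mul_eq_sum_range {p q : Polynomial ℤ} {N : ℕ} (hq : ∀ n < N, q.coeff n = 1)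
    {m : ℕ} (hm : m < N) : (p * q).coeff m = ∑ i ∈ Finset.range (m + 1), p.coeff i := by
  rw [Polynomial.coeff_mul, Finset.Nat.sum_antidiagonal_eq_sum_range_succ
    (fun i j => p.coeff i * q.coeff j)]
  refine Finset.sum_congr rfl fun i _ => ?_
  rw [hq _ (by omega), mul_one]

theorem triangleDirichlet_eq_sum_coeff (K k : ℕ) (hk : k ≤ 2 ^ K) (x : ℝ × ℝ) :
    triangleDirichlet k x = ((∑ m ∈ Finset.range k,
      (walshPoly (firstTerms K (bit x.1)) * walshPoly (firstTerms K (bit x.2))).coeff m : ℤ) : ℝ) := by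
  rw [triangleDirichlet, ← Finset.sum_range_diag_flip]
  push_cast
  refine Finset.sum_congr rfl fun m hm => ?_
  have hm := Finset.mem_range.1 hm
  rw [Polynomial.coeff_mul, Finset.Nat.sum_antidiagonal_eq_sum_range_succ (fun i j =>
    (walshPoly (firstTerms K (bit x.1))).coeff i * (walshPoly (firstTerms K (bit x.2))).coeff j)]
  push_cast
  refine Finset.sum_congr rfl fun i hi => ?_
  rw [walsh_eq_coeff K i (by simp at hi; omega), walsh_eq_coeff K (m - i) (by omega)]

/-- The sequence of pairs of binary digits of a point of the plane. -/
def bits (x : ℝ × ℝ) (j : ℕ) : Bool × Bool := (bit x.1 j, bit x.2 j)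

theorem abs_sum_triangleDirichlet_le (K n : ℕ) (hn : n ≤ 2 ^ K) (x : ℝ × ℝ) :
    |∑ k ∈ Finset.range n, triangleDirichlet k x| ≤ (diffHeight 0 (firstTerms K (bits x)) : ℝ) := by
  have hone : ∀ m < 2 ^ K, (walshPoly (firstTerms K fun _ => false)).coeff m = 1 := fun m hm => by
    simp [coeff_walshPoly K m hm, sign]
  set p := walshPoly (firstTerms K (bit x.1)) * walshPoly (firstTerms K (bit x.2)) with hp
  set q := walshPoly (firstTerms K fun _ => false) with hq
  have hQ : kernelPoly (firstTerms K (bits x)) = p * q * q := by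
    simp only [kernelPoly_eq, map_firstTerms, hp, hq, bits]
  -- As `D_0 = 0`, the sum vanishes for `n ≤ 1`; otherwise the sum of the first `n + 2` kernels is
  -- the coefficient of index `n`.
  rcases n with _ | _ | n
  · simp
  · simp [triangleDirichlet]
  have hsum : ∑ k ∈ Finset.range (n + 2), triangleDirichlet k x =
      (((kernelPoly (firstTerms K (bits x))).coeff n : ℤ) : ℝ) := by
    rw [hQ, coeff_mul_eq_sum_range hone (by omega), Finset.sum_range_succ']
    push_cast
    rw [show triangleDirichlet 0 x = 0 by simp [triangleDirichlet], add_zero]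
    refine Finset.sum_congr rfl fun k hk => ?_
    have hk := Finset.mem_range.1 hk
    rw [triangleDirichlet_eq_sum_coeff K (k + 1) (by omega),
      coeff_mul_eq_sum_range hone (by omega)]
  rw [hsum, ← Int.cast_abs, Int.abs_eq_natAbs]
  have := natAbs_coeff_le_height ((1 - Polynomial.X) ^ 0 * kernelPoly (firstTerms K (bits x))) n
  rw [pow_zero, one_mul] at this
  rw [diffHeight, pow_zero, one_mul]
  exact_mod_cast this

theorem ofReal_abs_triangleFejer_le (k n : ℕ) (hk : 2 ^ k ≤ n) (hn : n ≤ 2 ^ (k + 1))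
    (x : ℝ × ℝ) : ENNReal.ofReal |triangleFejer n x| ≤
      (2 ^ k)⁻¹ * (diffHeight 0 (firstTerms (k + 1) (bits x)) : ℝ≥0∞) := by
  have h := abs_sum_triangleDirichlet_le (k + 1) n hn x
  have hk' : (2 : ℝ) ^ k ≤ n := by exact_mod_cast hk
  have h2 : |triangleFejer n x| ≤ (2 ^ k)⁻¹ * (diffHeight 0 (firstTerms (k + 1) (bits x)) : ℝ) := by
    rw [triangleFejer, abs_mul, one_div, abs_of_nonneg (by positivity)]
    gcongr
  refine (ENNReal.ofReal_le_ofReal h2).trans_eq ?_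
  rw [ENNReal.ofReal_mul (by positivity), ENNReal.ofReal_natCast,
    ENNReal.ofReal_inv_of_pos (by positivity), ENNReal.ofReal_pow (by norm_num)]
  simp

/-! ### Self-similarity of the square and integration over digits -/

/-- The numerical value of a binary digit. -/
def bitVal (b : Bool) : ℝ := if b then 1 else 0

/-- The inverse branches of the doubling map on the unit square. -/
def halve (t : Bool × Bool) (x : ℝ × ℝ) : ℝ × ℝ :=
  (1 / 2 : ℝ) • x + (bitVal t.1 / 2, bitVal t.2 / 2)

/-- The half-open unit square. -/
def unitSquare : Set (ℝ × ℝ) := Set.Ico (0 : ℝ) 1 ×ˢ Set.Ico (0 : ℝ) 1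

theorem bit_halve_zero {x : ℝ} (hx : x ∈ Set.Ico (0 : ℝ) 1) (b : Bool) :
    bit (1 / 2 * x + bitVal b / 2) 0 = b := by
  have h : ⌊(1 / 2 * x + bitVal b / 2) * 2 ^ (0 + 1)⌋₊ = if b then 1 else 0 := by
    rw [Nat.floor_eq_iff (by have := hx.1; cases b <;> simp [bitVal] <;> positivity)]
    have := hx.1
    have := hx.2
    cases b <;> simp [bitVal] <;> constructor <;> linarith
  rw [bit, digit, h]
  cases b <;> simp

theorem bit_halve_succ {x : ℝ} (hx : x ∈ Set.Ico (0 : ℝ) 1) (b : Bool) (j : ℕ) :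
    bit (1 / 2 * x + bitVal b / 2) (j + 1) = bit x j := by
  have h : ⌊(1 / 2 * x + bitVal b / 2) * 2 ^ (j + 1 + 1)⌋₊ =
      ⌊x * 2 ^ (j + 1)⌋₊ + 2 * ((if b then 1 else 0) * 2 ^ j) := by
    rw [← Nat.floor_add_natCast (mul_nonneg hx.1 (by positivity))]
    congr 1
    cases b <;> simp [bitVal] <;> ring
  rw [bit, bit, digit, digit, h, Nat.add_mul_mod_self_left]

theorem firstTerms_bits_halve {x : ℝ × ℝ} (hx : x ∈ unitSquare) (t : Bool × Bool) (K : ℕ) :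
    firstTerms (K + 1) (bits (halve t x)) = t :: firstTerms K (bits x) := by
  simp only [firstTerms, bits, halve, Prod.fst_add, Prod.snd_add, Prod.smul_fst, Prod.smul_snd,
    smul_eq_mul, bit_halve_zero hx.1, bit_halve_zero hx.2, bit_halve_succ hx.1,
    bit_halve_succ hx.2]
  rfl

theorem measurableSet_unitSquare : MeasurableSet unitSquare :=
  measurableSet_Ico.prod measurableSet_Ico

theorem halve_injective (t : Bool × Bool) : Function.Injective (halve t) := fun x y h => by
  simpa [halve] using h

theorem hasFDerivAt_halve (t : Bool × Bool) (x : ℝ × ℝ) :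
    HasFDerivAt (halve t) ((1 / 2 : ℝ) • ContinuousLinearMap.id ℝ (ℝ × ℝ)) x :=
  ((hasFDerivAt_id x).const_smul (1 / 2 : ℝ)).add_const _

theorem mem_halve_image {t : Bool × Bool} {x : ℝ × ℝ} :
    x ∈ halve t '' unitSquare ↔
      (bitVal t.1 ≤ 2 * x.1 ∧ 2 * x.1 < bitVal t.1 + 1) ∧
      (bitVal t.2 ≤ 2 * x.2 ∧ 2 * x.2 < bitVal t.2 + 1) := by
  constructor
  · rintro ⟨y, ⟨⟨h1, h2⟩, h3, h4⟩, rfl⟩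
    simp [halve] at *
    refine ⟨⟨?_, ?_⟩, ?_, ?_⟩ <;> linarith
  · rintro ⟨⟨h1, h2⟩, h3, h4⟩
    refine ⟨(2 * x.1 - bitVal t.1, 2 * x.2 - bitVal t.2), ⟨⟨?_, ?_⟩, ?_, ?_⟩, ?_⟩
    · simpa using h1
    · simp; linarith
    · simpa using h3
    · simp; linarith
    · ext <;> simp [halve] <;> ring

theorem unitSquare_eq_iUnion : unitSquare = ⋃ t, halve t '' unitSquare := by
  ext x
  simp only [Set.mem_iUnion, mem_halve_image]
  constructor
  · rintro ⟨⟨h1, h2⟩, h3, h4⟩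
    have key : ∀ u : ℝ, 0 ≤ u → u < 1 → ∃ b, bitVal b ≤ 2 * u ∧ 2 * u < bitVal b + 1 := by
      intro u h0 h1
      rcases lt_or_ge (2 * u) 1 with h | h
      · exact ⟨false, by simp [bitVal]; constructor <;> linarith⟩
      · exact ⟨true, by simp [bitVal]; constructor <;> linarith⟩
    obtain ⟨b, hb⟩ := key _ h1 h2
    obtain ⟨c, hc⟩ := key _ h3 h4
    exact ⟨(b, c), hb, hc⟩
  · rintro ⟨⟨b, c⟩, ⟨h1, h2⟩, h3, h4⟩
    refine ⟨⟨?_, ?_⟩, ?_, ?_⟩ <;> cases b <;> cases c <;> simp [bitVal] at * <;> linarith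

theorem pairwise_disjoint_halve_image :
    Pairwise (Function.onFun Disjoint fun t => halve t '' unitSquare) := by
  intro s t hst
  refine Set.disjoint_left.2 fun x hs ht => hst ?_
  rw [mem_halve_image] at hs ht
  obtain ⟨b, c⟩ := s
  obtain ⟨b', c'⟩ := t
  obtain ⟨⟨h1, h2⟩, h3, h4⟩ := hs
  obtain ⟨⟨h5, h6⟩, h7, h8⟩ := ht
  have hb : b = b' := by
    cases b <;> cases b' <;> simp [bitVal] at * <;> linarith
  have hc : c = c' := by
    cases c <;> cases c' <;> simp [bitVal] at * <;> linarith
  rw [hb, hc]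

theorem lintegral_unitSquare_eq_sum (f : ℝ × ℝ → ℝ≥0∞) :
    ∫⁻ x in unitSquare, f x =
      4⁻¹ * ∑ t : Bool × Bool, ∫⁻ x in unitSquare, f (halve t x) := by
  have hdet : |((1 / 2 : ℝ) • ContinuousLinearMap.id ℝ (ℝ × ℝ)).det| = 1 / 4 := by
    rw [ContinuousLinearMap.det]
    rw [ContinuousLinearMap.toLinearMap_smul, LinearMap.det_smul,
      show ((ContinuousLinearMap.id ℝ (ℝ × ℝ) : ℝ × ℝ →L[ℝ] ℝ × ℝ) : ℝ × ℝ →ₗ[ℝ] ℝ × ℝ) =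
        LinearMap.id from rfl, LinearMap.det_id]
    norm_num
  have hm : ∀ t, MeasurableSet (halve t '' unitSquare) := fun t =>
    measurableSet_unitSquare.image_of_measurable_injOn
      (by unfold halve; fun_prop) (halve_injective t).injOn
  conv_lhs => rw [unitSquare_eq_iUnion, lintegral_iUnion hm pairwise_disjoint_halve_image,
    tsum_fintype]
  rw [Finset.mul_sum]
  refine Finset.sum_congr rfl fun t _ => ?_
  rw [lintegral_image_eq_lintegral_abs_det_fderiv_mul volume measurableSet_unitSquare
    (fun x _ => (hasFDerivAt_halve t x).hasFDerivWithinAt) (halve_injective t).injOn, hdet,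
    lintegral_const_mul' _ _ (by simp)]
  congr 1
  rw [one_div, ENNReal.ofReal_inv_of_pos (by norm_num)]
  norm_num

theorem lintegral_words (K : ℕ) (F : List (Bool × Bool) → ℕ) :
    ∫⁻ x in unitSquare, (F (firstTerms K (bits x)) : ℝ≥0∞) = (4 ^ K)⁻¹ * (sumWords K F : ℝ≥0∞) := by
  induction K generalizing F with
  | zero =>
    simp [firstTerms, sumWords, unitSquare, Measure.volume_eq_prod, Measure.prod_prod]
  | succ K ih =>
    rw [lintegral_unitSquare_eq_sum]
    have h : ∀ t, ∫⁻ x in unitSquare, (F (firstTerms (K + 1) (bits (halve t x))) : ℝ≥0∞) =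
        (4 ^ K)⁻¹ * (sumWords K (fun l => F (t :: l)) : ℝ≥0∞) := fun t => by
      rw [← ih]
      refine setLIntegral_congr_fun measurableSet_unitSquare fun x hx => ?_
      rw [firstTerms_bits_halve hx]
    simp only [h, ← Finset.mul_sum]
    rw [sumWords, ← mul_assoc, pow_succ', ENNReal.mul_inv (by simp) (by simp)]
    push_cast
    rfl

/-! ### Measurability and the estimate of the supremum -/

theorem measurable_bits (j : ℕ) : Measurable fun x => bits x j := by
  have h : Measurable fun x => bit x j := by
    have : Measurable fun x => digit x j := by
      unfold digit
      exact (measurable_of_countable (fun n : ℕ => n % 2)).comp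
        (Nat.measurable_floor.comp (by fun_prop))
    exact (measurable_of_countable fun n : ℕ => decide (n = 1)).comp this
  exact (h.comp measurable_fst).prodMk (h.comp measurable_snd)

theorem measurable_comp_firstTerms {α β : Type*} [MeasurableSpace α] [MeasurableSpace β]
    [Countable β] [MeasurableSingletonClass β] {b : α → ℕ → β} (hb : ∀ j, Measurable fun x => b x j)
    (K : ℕ) (F : List β → ℝ≥0∞) : Measurable fun x => F (firstTerms K (b x)) := by
  induction K generalizing b F with
  | zero => exact measurable_const (a := F [])
  | succ K ih =>
    have h : Measurable fun p : α × β => F (p.2 :: firstTerms K fun j => b p.1 (j + 1)) :=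
      measurable_from_prod_countable_left fun t => ih (fun j => hb (j + 1)) fun l => F (t :: l)
    exact h.comp (measurable_id.prodMk (hb 0))

theorem offHeight_eq_of_notMem {a K : ℕ} (hK : a ≤ K) {x : ℝ × ℝ}
    (hx : x ∈ unitSquare \ (dyadicInterval a 0 ×ˢ dyadicInterval a 0)) :
    offHeight a (firstTerms K (bits x)) = diffHeight 0 (firstTerms K (bits x)) := by
  refine if_neg fun hall => hx.2 ?_
  have hd : ∀ j < a, digit x.1 j = 0 ∧ digit x.2 j = 0 := fun j hj => by
    have := hall _ (mem_take_firstTerms hj (hj.trans_le hK) (bits x))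
    rw [bits, Prod.mk.injEq, bit, bit, decide_eq_false_iff_not, decide_eq_false_iff_not] at this
    unfold digit at this ⊢
    omega
  exact ⟨⟨hx.1.1, fun j hj => (hd j hj).1.trans (by simp [digit])⟩,
    ⟨hx.1.2, fun j hj => (hd j hj).2.trans (by simp [digit])⟩⟩

/-- Each `n ≥ 2^a` lies in a block `[2^(a + d), 2^(a + d + 1))`; the supremum over blocks is bounded
by their sum. -/
theorem iSup_triangleFejer_le (a : ℕ) {x : ℝ × ℝ}
    (hx : x ∈ unitSquare \ (dyadicInterval a 0 ×ˢ dyadicInterval a 0)) :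
    (⨆ (n : ℕ) (_ : 2 ^ a ≤ n), ENNReal.ofReal |triangleFejer n x|) ≤
      ∑' d : ℕ, (2 ^ (a + d))⁻¹ * (offHeight a (firstTerms (a + d + 1) (bits x)) : ℝ≥0∞) := by
  refine iSup₂_le fun n hn => ?_
  have hn0 : n ≠ 0 := (lt_of_lt_of_le (by positivity) hn).ne'
  obtain ⟨d, hd⟩ := Nat.exists_eq_add_of_le ((Nat.le_log_iff_pow_le one_lt_two hn0).2 hn)
  refine le_trans ?_ (ENNReal.le_tsum d)
  rw [offHeight_eq_of_notMem (by omega) hx, ← hd]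
  exact ofReal_abs_triangleFejer_le _ n (Nat.pow_log_le_self 2 hn0)
    (Nat.lt_pow_succ_log_self one_lt_two n).le x

theorem offHeight_term_le (a d : ℕ) :
    ((2 : ℝ≥0∞) ^ (a + d))⁻¹ * ((4 ^ (a + d + 1))⁻¹ * (sumWords (a + d + 1) (offHeight a) : ℝ≥0∞)) ≤
      ENNReal.ofReal (92 * (7 / 8) ^ d) := by
  have h : (sumWords (a + d + 1) (offHeight a) : ℝ) ≤ 46 * 7 ^ (d + 1) * 8 ^ a := by
    exact_mod_cast le_of_add_le_left (sumWords_offHeight_le a (d + 1))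
  have e : ((2 : ℝ≥0∞) ^ (a + d))⁻¹ *
      ((4 ^ (a + d + 1))⁻¹ * (sumWords (a + d + 1) (offHeight a) : ℝ≥0∞)) =
      ENNReal.ofReal ((2 ^ (a + d))⁻¹ * ((4 ^ (a + d + 1))⁻¹ * sumWords (a + d + 1) (offHeight a))) := by
    rw [ENNReal.ofReal_mul (by positivity), ENNReal.ofReal_mul (by positivity),
      ENNReal.ofReal_inv_of_pos (by positivity), ENNReal.ofReal_inv_of_pos (by positivity),
      ENNReal.ofReal_pow (by norm_num), ENNReal.ofReal_pow (by norm_num), ENNReal.ofReal_natCast]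
    simp
  rw [e]
  refine ENNReal.ofReal_le_ofReal ?_
  calc ((2 : ℝ) ^ (a + d))⁻¹ * ((4 ^ (a + d + 1))⁻¹ * sumWords (a + d + 1) (offHeight a))
      ≤ (2 ^ (a + d))⁻¹ * ((4 ^ (a + d + 1))⁻¹ * (46 * 7 ^ (d + 1) * 8 ^ a)) := by gcongr
    -- The power `8^a` cancels against `2^a * 4^a`, leaving `46 * 7 / 4 = 161 / 2`.
    _ = 161 / 2 * (7 / 8) ^ d := by
      rw [show (8 : ℝ) = 2 * 4 by norm_num, mul_pow, div_pow, mul_pow]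
      field_simp
      ring
    _ ≤ 92 * (7 / 8) ^ d := by gcongr; norm_num

end WalshTriangle

end

theorem lemma1 :
    ∃ C : ℝ≥0, ∀ a : ℕ,
      ∫⁻ x in (Set.Ico (0 : ℝ) 1 ×ˢ Set.Ico (0 : ℝ) 1) \
          (WalshTriangle.dyadicInterval a 0 ×ˢ WalshTriangle.dyadicInterval a 0),
        (⨆ (n : ℕ) (_ : 2 ^ a ≤ n), ENNReal.ofReal |WalshTriangle.triangleFejer n x|)
        ∂(volume : Measure (ℝ × ℝ)) ≤ (C : ℝ≥0∞) := by
  have hsum : Summable fun d : ℕ => (92 * (7 / 8) ^ d : ℝ) :=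
    (summable_geometric_of_lt_one (by norm_num) (by norm_num)).mul_left _
  refine ⟨(∑' d : ℕ, (92 * (7 / 8) ^ d : ℝ)).toNNReal, fun a => ?_⟩
  let g : ℕ → ℝ × ℝ → ℝ≥0∞ := fun d x => (2 ^ (a + d))⁻¹ *
    (WalshTriangle.offHeight a (WalshTriangle.firstTerms (a + d + 1) (WalshTriangle.bits x)) : ℝ≥0∞)
  have hgm : ∀ d, Measurable (g d) := fun d =>
    WalshTriangle.measurable_comp_firstTerms WalshTriangle.measurable_bits (a + d + 1)
      fun l => (2 ^ (a + d))⁻¹ * (WalshTriangle.offHeight a l : ℝ≥0∞)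
  calc _ ≤ ∫⁻ x in WalshTriangle.unitSquare \
          (WalshTriangle.dyadicInterval a 0 ×ˢ WalshTriangle.dyadicInterval a 0), ∑' d, g d x :=
        -- Only the majorant has to be measurable, not the supremum.
        setLIntegral_mono (.tsum hgm) fun x hx =>
          WalshTriangle.iSup_triangleFejer_le a hx
    _ ≤ ∫⁻ x in WalshTriangle.unitSquare, ∑' d, g d x := lintegral_mono_set Set.sdiff_subset
    _ = ∑' d, ∫⁻ x in WalshTriangle.unitSquare, g d x :=
        lintegral_tsum fun d => (hgm d).aemeasurable
    _ ≤ ∑' d, ENNReal.ofReal (92 * (7 / 8) ^ d) := by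
        refine ENNReal.tsum_le_tsum fun d => ?_
        rw [lintegral_const_mul' _ _ (by simp), WalshTriangle.lintegral_words]
        exact WalshTriangle.offHeight_term_le a d
    _ = _ := (ENNReal.ofReal_tsum_of_nonneg (fun d => by positivity) hsum).symm
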